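/- Let $\mathcal{G}$ be a finite directed graph (multiple edges and loops allowed) with vertex set $\mathfrak{V}$, edge set $\mathfrak{E}$ and source and range maps $s,r:\mathfrak{E}\to\mathfrak{V}$. Let $q\in\mathbb{C}$ with $q\neq 0$, $q^2\neq 1$, and $[m]=(q^m-q^{-m})/(q-q^{-1})$. Assume that the adjacency matrix of $\mathcal{G}$ has Perron-Frobenius eigenvalue $[3]$ with Perron-Frobenius eigenvector $\phi$, i.e. $\phi_v>0$ and $\sum_{s(e)=v}\phi_{r(e)}=[3]\phi_v$ for all $v\in\mathfrak{V}$. (For a finite $SU(3)$ $\mathcal{ADE}$ graph with Coxeter number $n$, $q=e^{\pi i/n}$.) Let $W$ be a cell system on $\mathcal{G}$: a complex number $W_{\alpha,\beta,\gamma}=W_{\beta,\gamma,\alpha}$ for every oriented triangle, i.e. closed path $\alpha\beta\gamma$ of length 3 (put $W_{\alpha,\beta,\gamma}=0$ for all other triples of edges), such that (I) if $s(\alpha)=s(\alpha')$ and $r(\alpha)=r(\alpha')$, then $\sum_{\beta,\gamma}W_{\alpha,\beta,\gamma}\overline{W_{\alpha',\beta,\gamma}}=\delta_{\alpha,\alpha'}[2]\,\phi_{s(\alpha)}\phi_{r(\alpha)}$;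 (II) if $s(\alpha_1)=s(\alpha_4)$, $s(\alpha_2)=s(\alpha_3)$, $r(\alpha_1)=r(\alpha_2)$, $r(\alpha_3)=r(\alpha_4)$, then $$\sum_{\beta,\beta',\gamma,\gamma'}\phi_{r(\beta)}^{-1}W_{\alpha_1,\beta,\gamma}\overline{W_{\alpha_2,\beta,\gamma'}}W_{\alpha_3,\beta',\gamma'}\overline{W_{\alpha_4,\beta',\gamma}}=\delta_{\alpha_1,\alpha_4}\delta_{\alpha_2,\alpha_3}\phi_{s(\alpha_1)}\phi_{r(\alpha_1)}\phi_{s(\alpha_2)}+\delta_{\alpha_1,\alpha_2}\delta_{\alpha_3,\alpha_4}\phi_{s(\alpha_1)}\phi_{r(\alpha_1)}\phi_{r(\alpha_3)}.$$ Fix a set $S\subseteq\mathfrak{V}$ of initial vertices (such as the $0$-coloured vertices). Let $M_k$ be the $*$-algebra with basis the matrix units $(\mu,\mu')$, where $\mu,\mu'$ are paths of length $k$ on $\mathcal{G}$ which start in $S$ and satisfy $r(\mu)=r(\mu')$; regard an element of $M_k$ as an element of $M_{k+1}$ through the unital $*$-homomorphism $(\mu,\mu')\mapsto\sum_{s(e)=r(\mu)}(\mu\cdot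 e,\mu'\cdot e)$. For $k\ge1$ define $U_k\in M_{k+1}$ by $$U_k=\sum_{\sigma,\beta_i,\gamma_i}\mathcal{U}^{\beta_2,\gamma_2}_{\beta_1,\gamma_1}\,(\sigma\cdot\beta_1\cdot\gamma_1,\ \sigma\cdot\beta_2\cdot\gamma_2),\qquad \mathcal{U}^{\rho_1,\rho_2}_{\rho_3,\rho_4}=\sum_{\lambda\in\mathfrak{E}}\phi_{s(\rho_1)}^{-1}\phi_{r(\rho_2)}^{-1}W_{\lambda,\rho_3,\rho_4}\overline{W_{\lambda,\rho_1,\rho_2}},$$ the sum being over the paths $\sigma$ of length $k-1$ starting in $S$ and the edges $\beta_i,\gamma_i$ for which $\sigma\cdot\beta_1\cdot\gamma_1$ and $\sigma\cdot\beta_2\cdot\gamma_2$ are paths with the same range. Then the $U_k$ satisfy the $SU(3)$-Temperley-Lieb relations with $\delta=[2]$: for every $N$, the elements $U_1,\dots,U_N$ of $M_{N+1}$ are self-adjoint and satisfy, for all indices in the range $1,\dots,N$, - H1: $U_i^2=\delta U_i$; - H2: $U_iU_j=U_jU_i$ if $|i-j|>1$; - H3: $U_iU_{i+1}U_i-U_i=U_{i+1}U_iU_{i+1}-U_{i+1}$;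 - vanishing of the $SU(3)$ $q$-antisymmetrizer: $(U_i-U_{i+2}U_{i+1}U_i+U_{i+1})(U_{i+1}U_{i+2}U_{i+1}-U_{i+1})=0$. -/

import Mathlib

open scoped BigOperators ComplexConjugate

universe u

/-- The quantum number `[m]_q = (q ^ m - q ^ (-m)) / (q - q ^ (-1))`. -/
noncomputable def qNumber (q : ℂ) (m : ℕ) : ℂ := (q ^ m - (q⁻¹) ^ m) / (q - q⁻¹)

/-- A directed graph with vertices `V` and edges `E`; multiple edges and loops are allowed.
`s e` and `r e` are the source and the range of the edge `e`. -/
structure EdgeGraph (V E : Type u) where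
  s : E → V
  r : E → V

namespace EdgeGraph

variable {V E : Type u} (G : EdgeGraph V E)

/-- `φ` is a Perron-Frobenius eigenvector of the adjacency matrix of `G`, with
Perron-Frobenius eigenvalue `ev`: all entries are strictly positive, and
`∑_w Δ(v, w) φ_w = ev * φ_v`, where `Δ(v, w)` is the number of edges from `v` to `w`. -/
def IsPerronFrobenius [Fintype V] [Fintype E] (φ : V → ℝ) (ev : ℂ) : Prop :=
  (∀ v, 0 < φ v) ∧
    ∀ v, ∑ w : V, (Nat.card {e : E // G.s e = v ∧ G.r e = w} : ℂ) * (φ w : ℂ) = ev * (φ v : ℂ)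

/-- `α`, `β`, `γ` are the consecutive edges of an oriented triangle (a closed path of length 3). -/
def IsTriangle (α β γ : E) : Prop :=
  G.r α = G.s β ∧ G.r β = G.s γ ∧ G.r γ = G.s α

/-- A cell system on `G` for the parameter `q` and the Perron-Frobenius eigenvector `φ`:
a complex number for each oriented triangle, subject to the type I and type II equations.
The cells are extended by `0` to the triples of edges that are not triangles, and do not depend
on the edge at which the triangle is started. -/
structure CellSystem [Fintype E] (q : ℂ) (φ : V → ℝ) where
  /-- `W α β γ` is the cell of the triangle with consecutive edges `α`, `β`, `γ`. -/
  W : E → E → E → ℂ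
  W_eq_zero : ∀ α β γ, ¬ G.IsTriangle α β γ → W α β γ = 0
  W_rotate : ∀ α β γ, W β γ α = W α β γ
  typeI_same : ∀ α : E,
    ∑ β : E, ∑ γ : E, W α β γ * conj (W α β γ)
      = qNumber q 2 * (φ (G.s α) : ℂ) * (φ (G.r α) : ℂ)
  typeI_ne : ∀ α α' : E, G.s α = G.s α' → G.r α = G.r α' → α ≠ α' →
    ∑ β : E, ∑ γ : E, W α β γ * conj (W α' β γ) = 0
  typeII : ∀ α₁ α₂ α₃ α₄ : E,
    G.s α₁ = G.s α₄ → G.s α₂ = G.s α₃ → G.r α₁ = G.r α₂ → G.r α₃ = G.r α₄ →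
    ∑ β : E, ∑ β' : E, ∑ γ : E, ∑ γ' : E, (φ (G.r β) : ℂ)⁻¹ *
        (W α₁ β γ * conj (W α₂ β γ') * W α₃ β' γ' * conj (W α₄ β' γ))
      = (open Classical in if α₁ = α₄ ∧ α₂ = α₃ then
          (φ (G.s α₁) : ℂ) * (φ (G.r α₁) : ℂ) * (φ (G.s α₂) : ℂ) else 0)
        + (open Classical in if α₁ = α₂ ∧ α₃ = α₄ then
          (φ (G.s α₁) : ℂ) * (φ (G.r α₁) : ℂ) * (φ (G.r α₃) : ℂ) else 0)

/-- The paths of length `k` on `G` starting at a vertex of `S`, together with the map sending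
a path to its range.  A path of length `k + 1` is a pair `(σ, e)` of a path `σ` of length `k`
and an edge `e` with `s(e) = r(σ)`. -/
def pathData (S : Set V) : ℕ → (P : Type u) × (P → V)
  | 0 => ⟨{v : V // v ∈ S}, Subtype.val⟩
  | k + 1 => ⟨{x : (pathData S k).1 × E // G.s x.2 = (pathData S k).2 x.1}, fun x => G.r x.1.2⟩

/-- The paths of length `k` on `G` starting at a vertex of `S`. -/
def Path (S : Set V) (k : ℕ) : Type u := (G.pathData S k).1

variable {G} {S : Set V}

/-- The range (end vertex) of a path. -/
def Path.range {k : ℕ} (μ : G.Path S k) : V := (G.pathData S k).2 μ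

/-- The path without its last edge. -/
def Path.init {k : ℕ} (μ : G.Path S (k + 1)) : G.Path S k := μ.1.1

/-- The last edge of a path. -/
def Path.last {k : ℕ} (μ : G.Path S (k + 1)) : E := μ.1.2

theorem Path.s_last {k : ℕ} (μ : G.Path S (k + 1)) : G.s μ.last = μ.init.range := μ.2

theorem Path.range_succ {k : ℕ} (μ : G.Path S (k + 1)) : μ.range = G.r μ.last := rfl

/-- The path `σ · e`. -/
def Path.snoc {k : ℕ} (σ : G.Path S k) (e : E) (h : G.s e = σ.range) : G.Path S (k + 1) :=
  ⟨(σ, e), h⟩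

theorem Path.ext_succ {k : ℕ} {μ ν : G.Path S (k + 1)} (h : μ.init = ν.init)
    (h' : μ.last = ν.last) : μ = ν := Subtype.ext (Prod.ext h h')

theorem Path.finite [Finite V] [Finite E] : ∀ k : ℕ, Finite (G.Path S k)
  | 0 => inferInstanceAs (Finite {v : V // v ∈ S})
  | k + 1 =>
    haveI : Finite (G.pathData S k).1 := Path.finite k
    inferInstanceAs (Finite {x : (G.pathData S k).1 × E // G.s x.2 = (G.pathData S k).2 x.1})

noncomputable instance [Fintype V] [Fintype E] (k : ℕ) : Fintype (G.Path S k) :=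
  haveI : Finite (G.Path S k) := Path.finite k
  Fintype.ofFinite _

noncomputable instance (k : ℕ) : DecidableEq (G.Path S k) := Classical.decEq _

variable (G S)

/-- The algebra `M_k` of the path algebra: it is spanned by the matrix units `(μ, ν)` with `μ`, `ν`
paths of length `k` that start in `S` and have the same range.  So `M_0 = ℂ ^ S`, and the
Bratteli diagram of `M_k ⊂ M_{k+1}` is given by `G`. -/
noncomputable def pathAlg [Fintype V] [Fintype E] (k : ℕ) :
    StarSubalgebra ℂ (Matrix (G.Path S k) (G.Path S k) ℂ) where
  carrier := {x | ∀ μ ν, μ.range ≠ ν.range → x μ ν = 0}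
  mul_mem' := by
    intro x y hx hy μ ν h
    rw [Matrix.mul_apply]
    refine Finset.sum_eq_zero fun κ _ => ?_
    by_cases h1 : μ.range = κ.range
    · rw [hy κ ν (fun h2 => h (h1.trans h2)), mul_zero]
    · rw [hx μ κ h1, zero_mul]
  add_mem' := by
    intro x y hx hy μ ν h
    rw [Matrix.add_apply, hx μ ν h, hy μ ν h, add_zero]
  algebraMap_mem' := by
    intro c μ ν h
    have hne : μ ≠ ν := fun e => h (congrArg _ e)
    simp [Matrix.algebraMap_matrix_apply, hne]
  star_mem' := by
    intro x hx μ ν h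
    rw [Matrix.star_apply, hx ν μ (Ne.symm h), star_zero]

open Classical in
/-- The matrix of the image in `M_{k+1}` of `x ∈ M_k`: the matrix unit `(μ, ν)` is sent to
`∑_e (μ · e, ν · e)`. -/
noncomputable def incMatrix {k : ℕ} (x : Matrix (G.Path S k) (G.Path S k) ℂ) :
    Matrix (G.Path S (k + 1)) (G.Path S (k + 1)) ℂ :=
  Matrix.of fun μ ν => if μ.last = ν.last then x μ.init ν.init else 0

variable {G S}

theorem incMatrix_one {k : ℕ} :
    G.incMatrix S (1 : Matrix (G.Path S k) (G.Path S k) ℂ) = 1 := by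
  ext μ ν
  simp only [incMatrix, Matrix.of_apply, Matrix.one_apply]
  by_cases h : μ = ν
  · subst h; simp
  · by_cases h1 : μ.last = ν.last
    · have h2 : μ.init ≠ ν.init := fun h2 => h (Path.ext_succ h2 h1)
      simp [h, h1, h2]
    · simp [h, h1]

theorem incMatrix_mul [Fintype V] [Fintype E] {k : ℕ}
    {x y : Matrix (G.Path S k) (G.Path S k) ℂ} (hx : x ∈ G.pathAlg S k) :
    G.incMatrix S (x * y) = G.incMatrix S x * G.incMatrix S y := by
  classical
  ext μ ν
  simp only [incMatrix, Matrix.of_apply, Matrix.mul_apply]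
  by_cases h1 : μ.last = ν.last
  · rw [if_pos h1]
    symm
    refine Finset.sum_bij_ne_zero (fun κ _ _ => κ.init) (fun _ _ _ => Finset.mem_univ _) ?_ ?_ ?_
    · intro κ _ hκ κ' _ hκ' h
      have e1 : μ.last = κ.last := by
        by_contra hc; simp [hc] at hκ
      have e2 : μ.last = κ'.last := by
        by_contra hc; simp [hc] at hκ'
      exact Path.ext_succ h (e1.symm.trans e2)
    · intro κ _ hκ
      have hr : μ.init.range = κ.range := by
        by_contra hc
        exact hκ (by rw [hx _ _ hc, zero_mul])
      refine ⟨κ.snoc μ.last (μ.s_last.trans hr), Finset.mem_univ _, ?_, rfl⟩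
      have e1 : (κ.snoc μ.last (μ.s_last.trans hr)).last = μ.last := rfl
      have e2 : (κ.snoc μ.last (μ.s_last.trans hr)).init = κ := rfl
      rw [e1, e2, if_pos rfl, if_pos h1]
      exact hκ
    · intro κ _ hκ
      have e1 : μ.last = κ.last := by
        by_contra hc; simp [hc] at hκ
      rw [if_pos e1, if_pos (e1.symm.trans h1)]
  · rw [if_neg h1]
    symm
    refine Finset.sum_eq_zero fun κ _ => ?_
    by_cases h2 : μ.last = κ.last
    · rw [if_neg (fun h3 : κ.last = ν.last => h1 (h2.trans h3)), mul_zero]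
    · rw [if_neg h2, zero_mul]

theorem incMatrix_mem [Fintype V] [Fintype E] {k : ℕ}
    (x : Matrix (G.Path S k) (G.Path S k) ℂ) : G.incMatrix S x ∈ G.pathAlg S (k + 1) := by
  intro μ ν h
  have h1 : μ.last ≠ ν.last := fun e => h (by rw [Path.range_succ, Path.range_succ, e])
  simp [incMatrix, h1]

variable (G S)

/-- The inclusion `M_k ⊂ M_{k+1}`. -/
noncomputable def pathInc [Fintype V] [Fintype E] (k : ℕ) :
    G.pathAlg S k →⋆ₐ[ℂ] G.pathAlg S (k + 1) where
  toFun x := ⟨G.incMatrix S x.1, incMatrix_mem x.1⟩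
  map_one' := Subtype.ext incMatrix_one
  map_mul' x y := Subtype.ext (incMatrix_mul x.2)
  map_zero' := by
    apply Subtype.ext
    ext μ ν
    simp [incMatrix]
  map_add' x y := by
    apply Subtype.ext
    ext μ ν
    by_cases h : μ.last = ν.last <;> simp [incMatrix, h]
  commutes' c := by
    apply Subtype.ext
    change G.incMatrix S (algebraMap ℂ (Matrix (G.Path S k) (G.Path S k) ℂ) c)
      = algebraMap ℂ (Matrix (G.Path S (k + 1)) (G.Path S (k + 1)) ℂ) c
    rw [Algebra.algebraMap_eq_smul_one, Algebra.algebraMap_eq_smul_one, ← incMatrix_one]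
    ext μ ν
    by_cases h : μ.last = ν.last <;> simp [incMatrix, h]
  map_star' x := by
    apply Subtype.ext
    change G.incMatrix S (star x.1) = star (G.incMatrix S x.1)
    ext μ ν
    by_cases h : μ.last = ν.last
    · simp [incMatrix, h, Matrix.star_apply]
    · simp [incMatrix, h, Ne.symm h, Matrix.star_apply]

/-- The inclusion `M_k ⊂ M_m` for `k ≤ m`. -/
noncomputable def pathEmb [Fintype V] [Fintype E] {k m : ℕ} (h : k ≤ m) :
    G.pathAlg S k →⋆ₐ[ℂ] G.pathAlg S m :=
  Nat.leRec (motive := fun m _ => G.pathAlg S k →⋆ₐ[ℂ] G.pathAlg S m)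
    (StarAlgHom.id ℂ (G.pathAlg S k)) (fun m _ f => (G.pathInc S m).comp f) h

variable {G}

/-- The weight `𝒰^{ρ₁, ρ₂}_{ρ₃, ρ₄} =
∑_λ φ_{s(ρ₁)}⁻¹ φ_{r(ρ₂)}⁻¹ W(λ, ρ₃, ρ₄) conj(W(λ, ρ₁, ρ₂))`. -/
noncomputable def CellSystem.weight [Fintype E] {q : ℂ} {φ : V → ℝ} (W : G.CellSystem q φ)
    (ρ₁ ρ₂ ρ₃ ρ₄ : E) : ℂ :=
  ∑ l : E, (φ (G.s ρ₁) : ℂ)⁻¹ * (φ (G.r ρ₂) : ℂ)⁻¹ * W.W l ρ₃ ρ₄ * conj (W.W l ρ₁ ρ₂)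

open Classical in
/-- The operator `U_{j+1} ∈ M_{j+2}`, that is
`U_{j+1} = ∑ 𝒰^{β₂, γ₂}_{β₁, γ₁} (σ · β₁ · γ₁, σ · β₂ · γ₂)`, the sum running over all paths `σ` of
length `j` and all edges `β₁, γ₁, β₂, γ₂` such that `σ · β₁ · γ₁` and `σ · β₂ · γ₂` are paths with
the same range. -/
noncomputable def CellSystem.U [Fintype V] [Fintype E] {q : ℂ} {φ : V → ℝ} (W : G.CellSystem q φ)
    (j : ℕ) : G.pathAlg S (j + 2) :=
  ⟨Matrix.of fun μ ν => if μ.init.init = ν.init.init ∧ μ.range = ν.range then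
      W.weight ν.init.last ν.last μ.init.last μ.last else 0, by
    intro μ ν h
    simp [h]⟩

end EdgeGraph

/-- The `SU(3)`-Temperley-Lieb relations with parameter `δ` for a finite family `U_1, …, U_N` of
self-adjoint operators in a unital `*`-algebra; the entry with index `i : Fin N` is `U_{i+1}`. -/
structure IsSU3TemperleyLieb {A : Type*} [Ring A] [StarRing A] [Algebra ℂ A] (δ : ℂ) {N : ℕ}
    (U : Fin N → A) : Prop where
  selfAdjoint : ∀ i, IsSelfAdjoint (U i)
  H1 : ∀ i, U i ^ 2 = δ • U i
  H2 : ∀ i j : Fin N, 1 < |((i : ℕ) : ℤ) - ((j : ℕ) : ℤ)| → U i * U j = U j * U i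
  H3 : ∀ i j : Fin N, (j : ℕ) = i + 1 →
    U i * U j * U i - U i = U j * U i * U j - U j
  /-- The vanishing of the `q`-antisymmetrizer. -/
  antisymmetrizer : ∀ i j k : Fin N, (j : ℕ) = i + 1 → (k : ℕ) = i + 2 →
    (U i - U k * U j * U i + U j) * (U j * U k * U j - U j) = 0

/-! In the weight `𝒰` both triangles share the edge `λ`, so the two Perron-Frobenius factors are
those of the ends of `λ`. Thus `U` acts on the last two edges as `∑_λ c_λ |W_λ⟩⟨W_λ|` with `c_λ =
(φ_{s(λ)} φ_{r(λ)})⁻¹`. Self-adjointness is then visible, and H1 is the orthogonality of the `W_λ`,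
which is type I. H2 holds because the operators act on disjoint sets of edges.

For H3, expanding both outer factors over `λ` turns the middle of `U₁U₂U₁` and of `U₂U₁U₂` into the
left side of type II. One Kronecker term returns `U₁`, respectively `U₂`; the other gives in both
cases the same operator `Q`, which on three edges has entries `φ_v⁻² W(a,b,c) conj W(a',b',c')`, `v`
being the common starting vertex. So `U₁U₂U₁ - U₁ = Q = U₂U₁U₂ - U₂` (`sum_weight_left`,
`sum_weight_right`).

For the antisymmetrizer let `M = U₂U₃U₂ - U₂ = U₃U₂U₃ - U₃`, the copy of `Q` one edge later. By H1,
`U₂M = U₃M = δM`. Type I contracts the two edges shared by `Q` and `M`, and rotating cells then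
gives `U₃QM = δU₁M` (`mul_triangle_mul_triangle`). Hence `δU₃U₂U₁M = U₃U₂U₁U₂M = U₃(Q + U₂)M = δ(U₁M
+ δM)`. Cancelling `δ` finishes the proof; if `δ = 0`, type I makes all cells, hence all `U_k`,
vanish. -/

namespace EdgeGraph

variable {V E : Type u} {G : EdgeGraph V E} {S : Set V}

/-! ### Operators acting on the last few edges of a path. -/

section LocalMatrix

variable {P B T : Type*}

open Classical in
/-- The matrix indexed by `P` that acts as the identity on the `base` of an index and as `F` on its
`word`. -/
noncomputable def localMatrix (base : P → B) (word : P → T) (F : Matrix T T ℂ) : Matrix P P ℂ :=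
  Matrix.of fun μ ν => if base μ = base ν then F (word μ) (word ν) else 0

theorem localMatrix_apply_of_eq {base : P → B} {word : P → T} {F : Matrix T T ℂ} {μ ν : P}
    (h : base μ = base ν) : localMatrix base word F μ ν = F (word μ) (word ν) := by
  simp [localMatrix, h]

theorem localMatrix_apply_of_ne {base : P → B} {word : P → T} {F : Matrix T T ℂ} {μ ν : P}
    (h : base μ ≠ base ν) : localMatrix base word F μ ν = 0 := by
  simp [localMatrix, h]

theorem localMatrix_congr {base : P → B} {word : P → T} {F H : Matrix T T ℂ}
    (h : ∀ μ ν, base μ = base ν → F (word μ) (word ν) = H (word μ) (word ν)) :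
    localMatrix base word F = localMatrix base word H := by
  ext μ ν
  by_cases hb : base μ = base ν
  · rw [localMatrix_apply_of_eq hb, localMatrix_apply_of_eq hb, h μ ν hb]
  · rw [localMatrix_apply_of_ne hb, localMatrix_apply_of_ne hb]

theorem localMatrix_sub {base : P → B} {word : P → T} {F H : Matrix T T ℂ} :
    localMatrix base word (F - H) = localMatrix base word F - localMatrix base word H := by
  ext μ ν
  by_cases hb : base μ = base ν <;> simp [localMatrix, hb]

theorem localMatrix_smul {base : P → B} {word : P → T} {F : Matrix T T ℂ} (c : ℂ) :
    localMatrix base word (c • F) = c • localMatrix base word F := by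
  ext μ ν
  by_cases hb : base μ = base ν <;> simp [localMatrix, hb]

/-- The product of `F` and `H` sums over all words, the product on paths only over realisable ones.
The two agree when `F` never leads from the word of a path to one that cannot follow the same base;
only the left factor has to be controlled. -/
theorem localMatrix_mul [Fintype P] [Fintype T] {base : P → B} {word : P → T}
    (hinj : ∀ μ ν, base μ = base ν → word μ = word ν → μ = ν) {F H : Matrix T T ℂ}
    (hF : ∀ μ w, F (word μ) w ≠ 0 → ∃ κ, base κ = base μ ∧ word κ = w) :
    localMatrix base word F * localMatrix base word H = localMatrix base word (F * H) := by
  ext μ ν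
  rw [Matrix.mul_apply]
  by_cases hb : base μ = base ν
  · rw [localMatrix_apply_of_eq hb, Matrix.mul_apply]
    have key : ∀ κ, localMatrix base word F μ κ * localMatrix base word H κ ν ≠ 0 →
        base μ = base κ := by
      intro κ h
      by_contra hc
      exact h (by rw [localMatrix_apply_of_ne hc, zero_mul])
    refine Finset.sum_bij_ne_zero (fun κ _ _ => word κ) (fun _ _ _ => Finset.mem_univ _) ?_ ?_ ?_
    · intro κ _ hκ κ' _ hκ' h
      exact hinj _ _ ((key κ hκ).symm.trans (key κ' hκ')) h
    · intro w _ hw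
      obtain ⟨κ, h1, h2⟩ := hF μ w (left_ne_zero_of_mul hw)
      refine ⟨κ, Finset.mem_univ _, ?_, h2⟩
      rw [localMatrix_apply_of_eq h1.symm, localMatrix_apply_of_eq (h1.trans hb), h2]
      exact hw
    · intro κ _ hκ
      have h1 := key κ hκ
      rw [localMatrix_apply_of_eq h1, localMatrix_apply_of_eq (h1.symm.trans hb)]
  · rw [localMatrix_apply_of_ne hb]
    refine Finset.sum_eq_zero fun κ _ => ?_
    by_cases h1 : base μ = base κ
    · rw [localMatrix_apply_of_ne (fun h2 => hb (h1.trans h2)), mul_zero]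
    · rw [localMatrix_apply_of_ne h1, zero_mul]

end LocalMatrix

/-! ### Identities between cells: consequences of type I and type II. -/

namespace CellSystem

section Sums

variable {ι : Type*} [Fintype ι]

theorem sum_reverse (F : ι → ι → ι → ℂ) :
    ∑ a, ∑ b, ∑ c, F a b c = ∑ c, ∑ b, ∑ a, F a b c := by
  rw [Finset.sum_comm, Finset.sum_comm (s := (Finset.univ : Finset ι)) (f := fun c b => ∑ a, F a b c)]
  exact Finset.sum_congr rfl fun b _ => Finset.sum_comm

theorem sum_rotate (F : ι → ι → ι → ℂ) :
    ∑ a, ∑ b, ∑ c, F a b c = ∑ b, ∑ c, ∑ a, F a b c := by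
  rw [Finset.sum_comm]
  exact Finset.sum_congr rfl fun b _ => Finset.sum_comm

/-- Sandwiching `B` between two sums of rank one operators reduces to the matrix coefficients of `B`
between the vectors `A l` and `C l'`. With weights as outer factors, these coefficients are what
type I and type II compute. -/
theorem sum_factor {κ : Type*} [Fintype κ] (P Q : ι → ℂ) (A C : ι → κ → ℂ) (B : κ → ℂ) :
    ∑ k, (∑ l, P l * A l k) * B k * (∑ l', C l' k * Q l')
      = ∑ l, ∑ l', P l * Q l' * ∑ k, A l k * B k * C l' k := by
  simp only [Finset.mul_sum, Finset.sum_mul]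
  rw [Finset.sum_comm, Finset.sum_comm (s := (Finset.univ : Finset ι)) (t := (Finset.univ : Finset ι))]
  refine Finset.sum_congr rfl fun l _ => ?_
  rw [Finset.sum_comm]
  refine Finset.sum_congr rfl fun l' _ => Finset.sum_congr rfl fun k _ => by ring

end Sums

section Cells

variable [Fintype E] {q : ℂ} {φ : V → ℝ} (W : G.CellSystem q φ)

theorem isTriangle_of_ne_zero {a b c : E} (h : W.W a b c ≠ 0) : G.IsTriangle a b c := by
  by_contra hc
  exact h (W.W_eq_zero _ _ _ hc)

theorem exists_of_weight_ne_zero {a b c d : E} (h : W.weight c d a b ≠ 0) :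
    G.r a = G.s b ∧ G.r c = G.s d ∧ G.s a = G.s c ∧ G.r b = G.r d := by
  obtain ⟨l, -, hl⟩ := Finset.exists_ne_zero_of_sum_ne_zero h
  have h1 := W.isTriangle_of_ne_zero (right_ne_zero_of_mul (left_ne_zero_of_mul hl))
  have h2 := W.isTriangle_of_ne_zero
    (fun h0 => right_ne_zero_of_mul hl (by rw [h0, map_zero]))
  exact ⟨h1.2.1, h2.2.1, h1.1.symm.trans h2.1, h1.2.2.trans h2.2.2.symm⟩

theorem conj_weight (a b c d : E) : conj (W.weight c d a b) = W.weight a b c d := by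
  rw [weight, weight, map_sum]
  refine Finset.sum_congr rfl fun l _ => ?_
  by_cases h1 : W.W l a b = 0
  · simp [h1]
  by_cases h2 : W.W l c d = 0
  · simp [h2]
  have t1 := W.isTriangle_of_ne_zero h1
  have t2 := W.isTriangle_of_ne_zero h2
  simp only [map_mul, map_inv₀, Complex.conj_ofReal, Complex.conj_conj]
  rw [← t1.1, ← t2.1, t1.2.2, t2.2.2]
  ring

/-- The weight with its normalisation read off from the edge that is summed over. -/
theorem weight_eq_left (a b c d : E) :
    W.weight c d a b =
      ∑ l, ((φ (G.r l) : ℂ)⁻¹ * (φ (G.s l) : ℂ)⁻¹ * W.W l a b) * conj (W.W l c d) := by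
  refine Finset.sum_congr rfl fun l _ => ?_
  by_cases h1 : W.W l a b = 0
  · simp [h1]
  by_cases h2 : W.W l c d = 0
  · simp [h2]
  have t2 := W.isTriangle_of_ne_zero h2
  rw [← t2.1, t2.2.2]

theorem weight_eq_right (a b c d : E) :
    W.weight c d a b =
      ∑ l, W.W l a b * ((φ (G.r l) : ℂ)⁻¹ * (φ (G.s l) : ℂ)⁻¹ * conj (W.W l c d)) := by
  rw [weight_eq_left]
  exact Finset.sum_congr rfl fun l _ => by ring

-- Type I freed from its incidence hypotheses: edges with different ends share no triangle
-- completion, so the sum vanishes termwise.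
open Classical in
theorem sum_W_conj_W (a a' : E) :
    ∑ β : E, ∑ γ : E, W.W a β γ * conj (W.W a' β γ)
      = if a = a' then qNumber q 2 * (φ (G.s a) : ℂ) * (φ (G.r a) : ℂ) else 0 := by
  by_cases h : a = a'
  · subst h; simpa using W.typeI_same a
  rw [if_neg h]
  by_cases hs : G.s a = G.s a' ∧ G.r a = G.r a'
  · exact W.typeI_ne a a' hs.1 hs.2 h
  · refine Finset.sum_eq_zero fun β _ => Finset.sum_eq_zero fun γ _ => ?_
    by_contra hne
    have t := W.isTriangle_of_ne_zero (left_ne_zero_of_mul hne)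
    have t' := W.isTriangle_of_ne_zero
      (fun h0 => right_ne_zero_of_mul hne (by rw [h0, map_zero]))
    exact hs ⟨t.2.2.symm.trans t'.2.2, t.1.trans t'.1.symm⟩

open Classical in
/-- The type II equation in the form in which it appears in `U₁ U₂ U₁`. -/
theorem typeII_left {l l' c c' : E} (hr : G.r l = G.r l') (hs : G.s l = G.s c)
    (hs' : G.s l' = G.s c') :
    ∑ x, ∑ y, ∑ y', conj (W.W l x y) * W.weight y' c' y c * W.W l' x y'
      = (φ (G.r c') : ℂ)⁻¹ * ((if l' = c' ∧ l = c then
          (φ (G.s l') : ℂ) * (φ (G.r l') : ℂ) * (φ (G.s l) : ℂ) else 0)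
        + (if l' = l ∧ c = c' then
          (φ (G.s l') : ℂ) * (φ (G.r l') : ℂ) * (φ (G.r c) : ℂ) else 0)) := by
  by_cases hc : G.r c = G.r c'
  -- The edge `m` hidden in the weight plays the role of `β'`, and `s(y') = r(x)` turns the first
  -- factor of the weight into the `φ_{r(β)}⁻¹` of type II.
  · rw [← W.typeII l' l c c' hs' hs hr.symm hc, Finset.mul_sum]
    refine Finset.sum_congr rfl fun x _ => ?_
    simp only [weight, Finset.mul_sum, Finset.sum_mul]
    rw [sum_reverse]
    refine Finset.sum_congr rfl fun m _ => Finset.sum_congr rfl fun y' _ =>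
      Finset.sum_congr rfl fun y _ => ?_
    by_cases h : W.W l' x y' = 0
    · simp [h]
    rw [← (W.isTriangle_of_ne_zero h).2.1, W.W_rotate c m y,
      W.W_rotate c' m y']
    ring
  -- Outside the scope of type II everything vanishes, since a nonzero weight preserves the range.
  · have h1 : ∀ y y', W.weight y' c' y c = 0 := fun y y' => by
      by_contra h
      exact hc (W.exists_of_weight_ne_zero h).2.2.2
    have h2 : ¬ (l' = c' ∧ l = c) := by
      rintro ⟨rfl, rfl⟩; exact hc hr
    have h3 : ¬ (l' = l ∧ c = c') := by
      rintro ⟨-, rfl⟩; exact hc rfl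
    simp [h1, h2, h3]

open Classical in
/-- The type II equation in the form in which it appears in `U₂ U₁ U₂`. -/
theorem typeII_right {a a' m m' : E} (hs : G.s a = G.s a') (hr : G.r a = G.r m)
    (hr' : G.r a' = G.r m') :
    ∑ y, ∑ z, ∑ y', conj (W.W m y z) * W.weight a' y' a y * W.W m' y' z
      = (φ (G.s a') : ℂ)⁻¹ * ((if a = a' ∧ m = m' then
          (φ (G.s a) : ℂ) * (φ (G.r a) : ℂ) * (φ (G.s m) : ℂ) else 0)
        + (if a = m ∧ m' = a' then
          (φ (G.s a) : ℂ) * (φ (G.r a) : ℂ) * (φ (G.r m') : ℂ) else 0)) := by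
  by_cases hc : G.s m = G.s m'
  · rw [← W.typeII a m m' a' hs hc hr hr'.symm, Finset.mul_sum]
    refine Finset.sum_congr rfl fun y _ => ?_
    simp only [weight, Finset.mul_sum, Finset.sum_mul]
    rw [sum_rotate]
    refine Finset.sum_congr rfl fun y' _ => Finset.sum_congr rfl fun l _ =>
      Finset.sum_congr rfl fun z _ => ?_
    by_cases h : W.W m y z = 0
    · simp [h]
    by_cases h' : W.W m' y' z = 0
    · simp [h']
    rw [(W.isTriangle_of_ne_zero h').2.1, ← (W.isTriangle_of_ne_zero h).2.1, W.W_rotate l a y,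
      W.W_rotate l a' y']
    ring
  · have h1 : ∀ y z y', conj (W.W m y z) * W.weight a' y' a y * W.W m' y' z = 0 := by
      intro y z y'
      by_cases h1 : W.W m y z = 0
      · simp [h1]
      by_cases h2 : W.W m' y' z = 0
      · simp [h2]
      exact absurd ((W.isTriangle_of_ne_zero h1).2.2.symm.trans
        (W.isTriangle_of_ne_zero h2).2.2) hc
    have h2 : ¬ (a = a' ∧ m = m') := by
      rintro ⟨-, rfl⟩; exact hc rfl
    have h3 : ¬ (a = m ∧ m' = a') := by
      rintro ⟨rfl, rfl⟩; exact hc hs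
    simp [h1, h2, h3]

/-- The rank one operators given by the triangles that start at a given vertex. -/
noncomputable def triangleWeight (a b c a' b' c' : E) : ℂ :=
  (φ (G.s a) : ℂ)⁻¹ ^ 2 * W.W a b c * conj (W.W a' b' c')

theorem sum_weight_mul_weight (hφ : ∀ v, 0 < φ v) (a b a' b' : E) :
    ∑ x, ∑ y, W.weight x y a b * W.weight a' b' x y = qNumber q 2 * W.weight a' b' a b := by
  classical
  have hφ0 : ∀ v, (φ v : ℂ) ≠ 0 := fun v => by exact_mod_cast (hφ v).ne'
  have h := sum_factor (κ := E × E) (fun l => (φ (G.r l) : ℂ)⁻¹ * (φ (G.s l) : ℂ)⁻¹ * W.W l a b)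
    (fun l => (φ (G.r l) : ℂ)⁻¹ * (φ (G.s l) : ℂ)⁻¹ * conj (W.W l a' b'))
    (fun l k => conj (W.W l k.1 k.2)) (fun l k => W.W l k.1 k.2) (fun _ => 1)
  simp only [Fintype.sum_prod_type, ← weight_eq_left, ← weight_eq_right, mul_one] at h
  rw [h, weight_eq_left, Finset.mul_sum]
  refine Finset.sum_congr rfl fun l _ => ?_
  simp only [mul_comm (conj _) (W.W _ _ _), sum_W_conj_W, mul_ite, mul_zero, Finset.sum_ite_eq',
    Finset.mem_univ, if_true]
  field_simp [hφ0]

-- The second Kronecker term of type II, `l = l'` and `c = c'`, rebuilds `U₁`; the first pins `l =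
-- c` and `l' = c'`, so that the cells close up to the triangles `abc` and `a'b'c'`.
open Classical in
theorem sum_weight_left (hφ : ∀ v, 0 < φ v) {a b c a' b' c' : E} (hb : G.r b = G.s c)
    (hb' : G.r b' = G.s c') (hs : G.s a = G.s a') :
    ∑ x, ∑ y, ∑ y', W.weight x y a b * W.weight y' c' y c * W.weight a' b' x y'
      = (if c = c' then W.weight a' b' a b else 0) + W.triangleWeight a b c a' b' c' := by
  have hφ0 : ∀ v, (φ v : ℂ) ≠ 0 := fun v => by exact_mod_cast (hφ v).ne'
  have h := sum_factor (κ := E × E × E)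
    (fun l => (φ (G.r l) : ℂ)⁻¹ * (φ (G.s l) : ℂ)⁻¹ * W.W l a b)
    (fun l => (φ (G.r l) : ℂ)⁻¹ * (φ (G.s l) : ℂ)⁻¹ * conj (W.W l a' b'))
    (fun l k => conj (W.W l k.1 k.2.1)) (fun l k => W.W l k.1 k.2.2)
    (fun k => W.weight k.2.2 c' k.2.1 c)
  simp only [Fintype.sum_prod_type, ← weight_eq_left, ← weight_eq_right] at h
  rw [h]
  have key : ∀ l l' : E, (φ (G.r l) : ℂ)⁻¹ * (φ (G.s l) : ℂ)⁻¹ * W.W l a b *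
        ((φ (G.r l') : ℂ)⁻¹ * (φ (G.s l') : ℂ)⁻¹ * conj (W.W l' a' b')) *
        ∑ x, ∑ y, ∑ y', conj (W.W l x y) * W.weight y' c' y c * W.W l' x y'
      = (if l = l' then if c = c' then
          (φ (G.r l) : ℂ)⁻¹ * (φ (G.s l) : ℂ)⁻¹ * W.W l a b * conj (W.W l a' b') else 0 else 0)
        + (if l = c then if l' = c' then W.triangleWeight a b c a' b' c' else 0 else 0) := by
    intro l l'
    by_cases h1 : W.W l a b = 0
    · have : l = c → W.W a b c = 0 := by rintro rfl; rw [W.W_rotate, h1]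
      simp only [h1, triangleWeight]
      split_ifs <;> simp_all
    by_cases h2 : W.W l' a' b' = 0
    · have : l' = c' → W.W a' b' c' = 0 := by rintro rfl; rw [W.W_rotate, h2]
      simp only [h2, triangleWeight]
      split_ifs <;> simp_all
    have t1 := W.isTriangle_of_ne_zero h1
    have t2 := W.isTriangle_of_ne_zero h2
    rw [W.typeII_left ((t1.1.trans hs).trans t2.1.symm) (t1.2.2.symm.trans hb)
      (t2.2.2.symm.trans hb')]
    have e1 : (if l' = c' ∧ l = c then
          (φ (G.s l') : ℂ) * (φ (G.r l') : ℂ) * (φ (G.s l) : ℂ) else 0) =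
        if l = c then if l' = c' then
          (φ (G.s l') : ℂ) * (φ (G.r l') : ℂ) * (φ (G.s l) : ℂ) else 0 else 0 := by
      split_ifs <;> simp_all
    have e2 : (if l' = l ∧ c = c' then
          (φ (G.s l') : ℂ) * (φ (G.r l') : ℂ) * (φ (G.r c) : ℂ) else 0) =
        if l = l' then if c = c' then
          (φ (G.s l') : ℂ) * (φ (G.r l') : ℂ) * (φ (G.r c) : ℂ) else 0 else 0 := by
      grind
    rw [e1, e2, mul_add, mul_add, add_comm]
    congr 1
    · split_ifs with h3 h4
      · subst h3 h4
        field_simp [hφ0]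
      · simp
      · simp
    · split_ifs with h3 h4
      · subst h3 h4
        rw [triangleWeight, ← t1.1, t2.1, ← hs, ← t1.1, W.W_rotate l a b, W.W_rotate l' a' b']
        field_simp [hφ0]
      · simp
      · simp
  simp only [key, Finset.sum_add_distrib, Finset.sum_ite_eq, Finset.sum_ite_eq', Finset.mem_univ,
    if_true, Finset.sum_ite_irrel, Finset.sum_const_zero]
  rw [weight_eq_left]

-- The mirror image of `sum_weight_left`: now the first Kronecker term of type II rebuilds `U₂` and
-- the second gives the triangles. That the triangle term is the same in both is H3.
open Classical in
theorem sum_weight_right (hφ : ∀ v, 0 < φ v) {a b c a' b' c' : E} (ha : G.r a = G.s b)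
    (ha' : G.r a' = G.s b') (hs : G.s a = G.s a') :
    ∑ y, ∑ z, ∑ y', W.weight y z b c * W.weight a' y' a y * W.weight b' c' y' z
      = (if a = a' then W.weight b' c' b c else 0) + W.triangleWeight a b c a' b' c' := by
  have hφ0 : ∀ v, (φ v : ℂ) ≠ 0 := fun v => by exact_mod_cast (hφ v).ne'
  have h := sum_factor (κ := E × E × E)
    (fun l => (φ (G.r l) : ℂ)⁻¹ * (φ (G.s l) : ℂ)⁻¹ * W.W l b c)
    (fun l => (φ (G.r l) : ℂ)⁻¹ * (φ (G.s l) : ℂ)⁻¹ * conj (W.W l b' c'))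
    (fun l k => conj (W.W l k.1 k.2.1)) (fun l k => W.W l k.2.2 k.2.1)
    (fun k => W.weight a' k.2.2 a k.1)
  simp only [Fintype.sum_prod_type, ← weight_eq_left, ← weight_eq_right] at h
  rw [h]
  have key : ∀ m m' : E, (φ (G.r m) : ℂ)⁻¹ * (φ (G.s m) : ℂ)⁻¹ * W.W m b c *
        ((φ (G.r m') : ℂ)⁻¹ * (φ (G.s m') : ℂ)⁻¹ * conj (W.W m' b' c')) *
        ∑ y, ∑ z, ∑ y', conj (W.W m y z) * W.weight a' y' a y * W.W m' y' z
      = (if m = m' then if a = a' then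
          (φ (G.r m) : ℂ)⁻¹ * (φ (G.s m) : ℂ)⁻¹ * W.W m b c * conj (W.W m b' c') else 0 else 0)
        + (if m = a then if m' = a' then W.triangleWeight a b c a' b' c' else 0 else 0) := by
    intro m m'
    by_cases h1 : W.W m b c = 0
    · simp only [h1, triangleWeight]
      split_ifs <;> simp_all
    by_cases h2 : W.W m' b' c' = 0
    · simp only [h2, triangleWeight]
      split_ifs <;> simp_all
    have t1 := W.isTriangle_of_ne_zero h1
    have t2 := W.isTriangle_of_ne_zero h2
    rw [W.typeII_right hs (ha.trans t1.1.symm) (ha'.trans t2.1.symm)]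
    have e1 : (if a = a' ∧ m = m' then
          (φ (G.s a) : ℂ) * (φ (G.r a) : ℂ) * (φ (G.s m) : ℂ) else 0) =
        if m = m' then if a = a' then
          (φ (G.s a) : ℂ) * (φ (G.r a) : ℂ) * (φ (G.s m) : ℂ) else 0 else 0 := by
      split_ifs <;> simp_all
    have e2 : (if a = m ∧ m' = a' then
          (φ (G.s a) : ℂ) * (φ (G.r a) : ℂ) * (φ (G.r m') : ℂ) else 0) =
        if m = a then if m' = a' then
          (φ (G.s a) : ℂ) * (φ (G.r a) : ℂ) * (φ (G.r m') : ℂ) else 0 else 0 := by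
      grind
    rw [e1, e2, mul_add, mul_add]
    congr 1
    · split_ifs with h3 h4
      · subst h3 h4
        rw [ha, ← t1.1]
        field_simp [hφ0]
      · simp
      · simp
    · split_ifs with h3 h4
      · subst h3 h4
        rw [triangleWeight, ← hs]
        field_simp [hφ0]
      · simp
      · simp
  simp only [key, Finset.sum_add_distrib, Finset.sum_ite_eq, Finset.sum_ite_eq', Finset.mem_univ,
    if_true, Finset.sum_ite_irrel, Finset.sum_const_zero]
  rw [weight_eq_left]

-- The entries of `QM`: the sum over the two shared edges is a type I sum, which leaves a single
-- Kronecker delta.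
open Classical in
theorem sum_triangleWeight_mul (hφ : ∀ v, 0 < φ v) {e e' : E} (hs : G.s e = G.s e')
    (a b c a' b' c' : E) :
    ∑ x, ∑ y, W.triangleWeight e a b e' x y * W.triangleWeight x y c a' b' c'
      = if c = e' then qNumber q 2 * ((φ (G.s e) : ℂ)⁻¹ * (φ (G.r e') : ℂ)⁻¹ *
          W.W e a b * conj (W.W a' b' c')) else 0 := by
  have hφ0 : ∀ v, (φ v : ℂ) ≠ 0 := fun v => by exact_mod_cast (hφ v).ne'
  have h : ∀ x y, W.triangleWeight e a b e' x y * W.triangleWeight x y c a' b' c' =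
      (φ (G.s e) : ℂ)⁻¹ ^ 2 * (φ (G.r e') : ℂ)⁻¹ ^ 2 * W.W e a b * conj (W.W a' b' c') *
        (W.W c x y * conj (W.W e' x y)) := by
    intro x y
    by_cases h1 : W.W e' x y = 0
    · simp [h1, triangleWeight]
    rw [triangleWeight, triangleWeight, ← (W.isTriangle_of_ne_zero h1).1, W.W_rotate c x y]
    ring
  simp only [h, ← Finset.mul_sum, sum_W_conj_W]
  split_ifs with h3
  · subst h3
    rw [hs]
    field_simp [hφ0]
  · simp

/-- No cell equation is needed: after rotating the cells, the summation edge `x` and the edge inside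
the weight exchange roles. This is how `U₃` acting on `QM` becomes `U₁M`. -/
theorem sum_weight_mul_W {e e' a b : E} (hs : G.s e = G.s e') (ha : G.r a = G.s b)
    (c a' b' c' : E) :
    (φ (G.s e) : ℂ)⁻¹ * (φ (G.r e') : ℂ)⁻¹ * conj (W.W a' b' c') *
        ∑ x, W.weight x e' b c * W.W e a x
      = ∑ x, W.weight e' x e a * W.triangleWeight x b c a' b' c' := by
  simp only [weight, Finset.mul_sum, Finset.sum_mul]
  rw [Finset.sum_comm]
  refine Finset.sum_congr rfl fun x _ => Finset.sum_congr rfl fun l _ => ?_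
  by_cases h1 : W.W l e a = 0
  · rw [W.W_rotate l e a, h1]; simp
  by_cases h2 : W.W x b c = 0
  · rw [triangleWeight, h2]; simp
  by_cases h3 : W.W l e' x = 0
  · rw [← W.W_rotate x l e', h3]; simp
  have t1 := W.isTriangle_of_ne_zero h1
  have t2 := W.isTriangle_of_ne_zero h2
  have t3 := W.isTriangle_of_ne_zero h3
  rw [triangleWeight, W.W_rotate l e a, W.W_rotate x l e', ← t1.2.2, ha, ← t2.1, ← t3.2.1, hs]
  ring

end Cells
end CellSystem

/-! ### Words of edges, and extending operators by one letter. -/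

/-- The last two edges of a path. -/
def Path.word₂ {k : ℕ} (μ : G.Path S (k + 2)) : E × E := (μ.init.last, μ.last)

/-- The last three edges of a path. -/
def Path.word₃ {k : ℕ} (μ : G.Path S (k + 3)) : E × E × E :=
  (μ.init.init.last, μ.init.last, μ.last)

/-- The last four edges of a path. -/
def Path.word₄ {k : ℕ} (μ : G.Path S (k + 4)) : E × E × E × E :=
  (μ.init.init.init.last, μ.init.init.last, μ.init.last, μ.last)

def Path.base₂ {k : ℕ} (μ : G.Path S (k + 2)) : G.Path S k := μ.init.init

def Path.base₃ {k : ℕ} (μ : G.Path S (k + 3)) : G.Path S k := μ.init.init.init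

def Path.base₄ {k : ℕ} (μ : G.Path S (k + 4)) : G.Path S k := μ.init.init.init.init

theorem Path.s_last_init {k : ℕ} (μ : G.Path S (k + 2)) : G.s μ.last = G.r μ.init.last :=
  μ.s_last

theorem Path.ext₂ {k : ℕ} (μ ν : G.Path S (k + 2)) (h : μ.base₂ = ν.base₂)
    (h' : μ.word₂ = ν.word₂) : μ = ν :=
  Path.ext_succ (Path.ext_succ h (congrArg (·.1) h')) (congrArg (·.2) h')

theorem Path.ext₃ {k : ℕ} (μ ν : G.Path S (k + 3)) (h : μ.base₃ = ν.base₃)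
    (h' : μ.word₃ = ν.word₃) : μ = ν :=
  Path.ext₂ μ ν (Path.ext_succ h (congrArg (·.1) h')) (congrArg (·.2) h')

theorem Path.ext₄ {k : ℕ} (μ ν : G.Path S (k + 4)) (h : μ.base₄ = ν.base₄)
    (h' : μ.word₄ = ν.word₄) : μ = ν :=
  Path.ext₃ μ ν (Path.ext_succ h (congrArg (·.1) h')) (congrArg (·.2) h')

theorem Path.exists₂ {k : ℕ} (σ : G.Path S k) (w : E × E) (h1 : G.s w.1 = σ.range)
    (h2 : G.r w.1 = G.s w.2) : ∃ κ : G.Path S (k + 2), κ.base₂ = σ ∧ κ.word₂ = w :=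
  ⟨(σ.snoc w.1 h1).snoc w.2 h2.symm, rfl, rfl⟩

theorem Path.exists₃ {k : ℕ} (σ : G.Path S k) (w : E × E × E) (h1 : G.s w.1 = σ.range)
    (h2 : G.r w.1 = G.s w.2.1) (h3 : G.r w.2.1 = G.s w.2.2) :
    ∃ κ : G.Path S (k + 3), κ.base₃ = σ ∧ κ.word₃ = w :=
  ⟨((σ.snoc w.1 h1).snoc w.2.1 h2.symm).snoc w.2.2 h3.symm, rfl, rfl⟩

theorem Path.exists₄ {k : ℕ} (σ : G.Path S k) (w : E × E × E × E) (h1 : G.s w.1 = σ.range)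
    (h2 : G.r w.1 = G.s w.2.1) (h3 : G.r w.2.1 = G.s w.2.2.1) (h4 : G.r w.2.2.1 = G.s w.2.2.2) :
    ∃ κ : G.Path S (k + 4), κ.base₄ = σ ∧ κ.word₄ = w :=
  ⟨(((σ.snoc w.1 h1).snoc w.2.1 h2.symm).snoc w.2.2.1 h3.symm).snoc w.2.2.2 h4.symm, rfl, rfl⟩

open Classical in
/-- The identity on the first letter and `F` on the others. -/
noncomputable def consMatrix {T : Type*} (F : Matrix T T ℂ) : Matrix (E × T) (E × T) ℂ :=
  Matrix.of fun p q => if p.1 = q.1 then F p.2 q.2 else 0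

open Classical in
/-- The identity on the last letter and `F` on the first two. -/
noncomputable def snocMatrix₂ (F : Matrix (E × E) (E × E) ℂ) :
    Matrix (E × E × E) (E × E × E) ℂ :=
  Matrix.of fun p q => if p.2.2 = q.2.2 then F (p.1, p.2.1) (q.1, q.2.1) else 0

open Classical in
/-- The identity on the last letter and `F` on the first three. -/
noncomputable def snocMatrix₃ (F : Matrix (E × E × E) (E × E × E) ℂ) :
    Matrix (E × E × E × E) (E × E × E × E) ℂ :=
  Matrix.of fun p q =>
    if p.2.2.2 = q.2.2.2 then F (p.1, p.2.1, p.2.2.1) (q.1, q.2.1, q.2.2.1) else 0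

theorem ite_ite_zero_comm {p r : Prop} {_ : Decidable p} {_ : Decidable r} (x : ℂ) :
    (if p then if r then x else 0 else 0) = if r then if p then x else 0 else 0 := by
  split_ifs <;> rfl

theorem ite_zero_of_iff_and {p r t : Prop} {_ : Decidable p} {_ : Decidable r}
    {_ : Decidable t} (x : ℂ)
    (h : p ↔ r ∧ t) : (if p then x else 0) = if r then if t then x else 0 else 0 := by
  by_cases hr : r <;> by_cases ht : t <;> simp [h, hr, ht]

theorem ite_and_zero_of_imp {p r : Prop} {_ : Decidable (p ∧ r)} {_ : Decidable p} {x : ℂ}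
    (h : x ≠ 0 → r) : (if p ∧ r then x else 0) = if p then x else 0 := by
  by_cases hr : r
  · simp [hr]
  · simp [not_imp_comm.1 h hr]

/-- The two sides test equality of base and of last letter in opposite orders. -/
theorem incMatrix_localMatrix₂ {k : ℕ} (F : Matrix (E × E) (E × E) ℂ) :
    G.incMatrix S (localMatrix (Path.base₂ (k := k)) Path.word₂ F)
      = localMatrix Path.base₃ Path.word₃ (snocMatrix₂ F) := by
  ext μ ν
  exact ite_ite_zero_comm _

theorem incMatrix_localMatrix₃ {k : ℕ} (F : Matrix (E × E × E) (E × E × E) ℂ) :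
    G.incMatrix S (localMatrix (Path.base₃ (k := k)) Path.word₃ F)
      = localMatrix Path.base₄ Path.word₄ (snocMatrix₃ F) := by
  ext μ ν
  exact ite_ite_zero_comm _

theorem Path.eq_iff_init_last {k : ℕ} {μ ν : G.Path S (k + 1)} :
    μ = ν ↔ μ.init = ν.init ∧ μ.last = ν.last :=
  ⟨by rintro rfl; exact ⟨rfl, rfl⟩, fun h => Path.ext_succ h.1 h.2⟩

/-- The last edge of the base is moved into the word, so that consecutive `U`'s act over a common
base. -/
theorem localMatrix_consMatrix₂ {k : ℕ} (F : Matrix (E × E) (E × E) ℂ) :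
    localMatrix (Path.base₂ (G := G) (S := S) (k := k + 1)) Path.word₂ F
      = localMatrix (Path.base₃ (k := k)) Path.word₃ (consMatrix F) := by
  ext μ ν
  exact ite_zero_of_iff_and _ Path.eq_iff_init_last

theorem localMatrix_consMatrix₃ {k : ℕ} (F : Matrix (E × E × E) (E × E × E) ℂ) :
    localMatrix (Path.base₃ (G := G) (S := S) (k := k + 1)) Path.word₃ F
      = localMatrix (Path.base₄ (k := k)) Path.word₄ (consMatrix F) := by
  ext μ ν
  exact ite_zero_of_iff_and _ Path.eq_iff_init_last

theorem Path.s_word₃_eq {k : ℕ} {μ ν : G.Path S (k + 3)} (h : μ.base₃ = ν.base₃) :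
    G.s μ.word₃.1 = G.s ν.word₃.1 :=
  (μ.init.init.s_last.trans (congrArg Path.range h)).trans ν.init.init.s_last.symm

/-! ### The operators `U` and `Q` as local matrices, and their products. -/

namespace CellSystem

variable [Fintype E] {q : ℂ} {φ : V → ℝ} (W : G.CellSystem q φ)

/-- The matrix of weights on the words of two edges. -/
noncomputable def weightMatrix : Matrix (E × E) (E × E) ℂ :=
  Matrix.of fun p p' => W.weight p'.1 p'.2 p.1 p.2

open Classical in
/-- The matrix of the operators given by triangles on the words of three edges. -/
noncomputable def triangleMatrix : Matrix (E × E × E) (E × E × E) ℂ :=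
  Matrix.of fun p p' => if G.s p.1 = G.s p'.1 then
    W.triangleWeight p.1 p.2.1 p.2.2 p'.1 p'.2.1 p'.2.2 else 0

theorem exists_of_triangleWeight_ne_zero {a b c a' b' c' : E}
    (h : W.triangleWeight a b c a' b' c' ≠ 0) : G.IsTriangle a b c ∧ G.IsTriangle a' b' c' :=
  ⟨W.isTriangle_of_ne_zero fun h0 => h (by rw [triangleWeight, h0, mul_zero, zero_mul]),
    W.isTriangle_of_ne_zero fun h0 => h (by rw [triangleWeight, h0, map_zero, mul_zero])⟩

/-- This lemma and the similar ones below supply the realisability hypothesis of `localMatrix_mul`: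
a nonzero entry keeps the outer vertices, so the new word still fits after the base. -/
theorem snocMatrix₂_range {k : ℕ} (μ : G.Path S (k + 3)) (w : E × E × E)
    (h : snocMatrix₂ W.weightMatrix μ.word₃ w ≠ 0) :
    ∃ κ : G.Path S (k + 3), κ.base₃ = μ.base₃ ∧ κ.word₃ = w := by
  simp only [snocMatrix₂, Path.word₃, Matrix.of_apply, weightMatrix] at h
  split_ifs at h with h0
  · have h1 := W.exists_of_weight_ne_zero h
    refine Path.exists₃ _ _ (h1.2.2.1.symm.trans μ.init.init.s_last) h1.2.1 ?_
    rw [← h0, ← h1.2.2.2, μ.s_last_init]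
  · exact absurd rfl h

theorem consMatrix₂_range {k : ℕ} (μ : G.Path S (k + 3)) (w : E × E × E)
    (h : consMatrix W.weightMatrix μ.word₃ w ≠ 0) :
    ∃ κ : G.Path S (k + 3), κ.base₃ = μ.base₃ ∧ κ.word₃ = w := by
  simp only [consMatrix, Path.word₃, Matrix.of_apply, weightMatrix] at h
  split_ifs at h with h0
  · have h1 := W.exists_of_weight_ne_zero h
    refine Path.exists₃ _ _ ?_ ?_ h1.2.1
    · rw [← h0]; exact μ.init.init.s_last
    · rw [← h0, ← h1.2.2.1, μ.init.s_last_init]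
  · exact absurd rfl h

theorem snocMatrix₂_snoc_range {k : ℕ} (μ : G.Path S (k + 4)) (w : E × E × E × E)
    (h : snocMatrix₃ (snocMatrix₂ W.weightMatrix) μ.word₄ w ≠ 0) :
    ∃ κ : G.Path S (k + 4), κ.base₄ = μ.base₄ ∧ κ.word₄ = w := by
  simp only [snocMatrix₂, snocMatrix₃, Path.word₄, Matrix.of_apply, weightMatrix] at h
  split_ifs at h with h0 h0'
  · have h1 := W.exists_of_weight_ne_zero h
    refine Path.exists₄ _ _ (h1.2.2.1.symm.trans μ.init.init.init.s_last) h1.2.1 ?_ ?_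
    · rw [← h0', ← h1.2.2.2, μ.init.s_last_init]
    · rw [← h0, ← h0', μ.s_last_init]
  · exact absurd rfl h
  · exact absurd rfl h

theorem consMatrix_cons_range {k : ℕ} (μ : G.Path S (k + 4)) (w : E × E × E × E)
    (h : consMatrix (consMatrix W.weightMatrix) μ.word₄ w ≠ 0) :
    ∃ κ : G.Path S (k + 4), κ.base₄ = μ.base₄ ∧ κ.word₄ = w := by
  simp only [consMatrix, Path.word₄, Matrix.of_apply, weightMatrix] at h
  split_ifs at h with h0 h0'
  · have h1 := W.exists_of_weight_ne_zero h
    refine Path.exists₄ _ _ ?_ ?_ ?_ h1.2.1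
    · rw [← h0]; exact μ.init.init.init.s_last
    · rw [← h0, ← h0', μ.init.init.s_last_init]
    · rw [← h0', ← h1.2.2.1, μ.init.s_last_init]
  · exact absurd rfl h
  · exact absurd rfl h

theorem weightMatrix_range {k : ℕ} (μ : G.Path S (k + 2)) (w : E × E)
    (h : W.weightMatrix μ.word₂ w ≠ 0) :
    ∃ κ : G.Path S (k + 2), κ.base₂ = μ.base₂ ∧ κ.word₂ = w := by
  have h1 := W.exists_of_weight_ne_zero h
  exact Path.exists₂ _ _ (h1.2.2.1.symm.trans μ.init.s_last) h1.2.1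

theorem triangleMatrix_snoc_range {k : ℕ} (μ : G.Path S (k + 4)) (w : E × E × E × E)
    (h : snocMatrix₃ W.triangleMatrix μ.word₄ w ≠ 0) :
    ∃ κ : G.Path S (k + 4), κ.base₄ = μ.base₄ ∧ κ.word₄ = w := by
  simp only [snocMatrix₃, Path.word₄, Matrix.of_apply, triangleMatrix] at h
  split_ifs at h with h0 hw
  · have h1 := W.exists_of_triangleWeight_ne_zero h
    refine Path.exists₄ _ _ (hw.symm.trans μ.init.init.init.s_last) h1.2.1 h1.2.2.1 ?_
    rw [h1.2.2.2, ← hw, ← h0, μ.s_last_init]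
    exact h1.1.2.2.symm
  · exact absurd rfl h
  · exact absurd rfl h

theorem snocMatrix₂_mul_consMatrix_mul_snocMatrix₂_apply (a b c a' b' c' : E) :
    (snocMatrix₂ W.weightMatrix * (consMatrix W.weightMatrix * snocMatrix₂ W.weightMatrix) :
      Matrix (E × E × E) (E × E × E) ℂ)
        (a, b, c) (a', b', c')
      = ∑ x, ∑ y, ∑ y', W.weight x y a b * W.weight y' c' y c * W.weight a' b' x y' := by
  classical
  simp [Matrix.mul_apply, Fintype.sum_prod_type, snocMatrix₂, consMatrix, weightMatrix,
    Finset.mul_sum, mul_assoc]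

theorem consMatrix_mul_snocMatrix₂_mul_consMatrix_apply (a b c a' b' c' : E) :
    (consMatrix W.weightMatrix * (snocMatrix₂ W.weightMatrix * consMatrix W.weightMatrix) :
      Matrix (E × E × E) (E × E × E) ℂ)
        (a, b, c) (a', b', c')
      = ∑ y, ∑ z, ∑ y', W.weight y z b c * W.weight a' y' a y * W.weight b' c' y' z := by
  classical
  simp [Matrix.mul_apply, Fintype.sum_prod_type, snocMatrix₂, consMatrix, weightMatrix,
    Finset.mul_sum, mul_assoc]

open Classical in
theorem snocMatrix₃_mul_consMatrix_triangleMatrix_apply (hφ : ∀ v, 0 < φ v)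
    {e e' a' : E} (ha' : G.r e' = G.s a') (a b c b' c' : E) :
    (snocMatrix₃ W.triangleMatrix * consMatrix W.triangleMatrix :
      Matrix (E × E × E × E) (E × E × E × E) ℂ) (e, a, b, c) (e', a', b', c')
      = if G.s e = G.s e' then if c = e' then qNumber q 2 * ((φ (G.s e) : ℂ)⁻¹ *
          (φ (G.r e') : ℂ)⁻¹ * W.W e a b * conj (W.W a' b' c')) else 0 else 0 := by
  -- The source test in the second triangle matrix is automatic: a nonzero first factor makes `e' x`
  -- composable, so `s(x) = r(e') = s(a')`.
  have h : ∀ x y, (W.triangleWeight e a b e' x y *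
      if G.s x = G.s a' then W.triangleWeight x y c a' b' c' else 0)
        = W.triangleWeight e a b e' x y * W.triangleWeight x y c a' b' c' := by
    intro x y
    by_cases h1 : W.triangleWeight e a b e' x y = 0
    · simp [h1]
    · rw [if_pos ((W.exists_of_triangleWeight_ne_zero h1).2.1.symm.trans ha')]
  by_cases hs : G.s e = G.s e'
  · rw [if_pos hs, ← W.sum_triangleWeight_mul hφ hs]
    simp only [Matrix.mul_apply, Fintype.sum_prod_type, snocMatrix₃, consMatrix, triangleMatrix,
      Matrix.of_apply, ite_mul, mul_ite, zero_mul, mul_zero, Finset.sum_ite_eq, Finset.sum_ite_eq',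
      Finset.mem_univ, if_true, Finset.sum_ite_irrel, Finset.sum_const_zero, hs]
    refine Finset.sum_congr rfl fun x _ => ?_
    by_cases hx : G.s x = G.s a'
    · rw [if_pos hx]
    · rw [if_neg hx]
      exact (Finset.sum_eq_zero fun y _ => by simpa [hx] using (h x y).symm).symm
  · simp [Matrix.mul_apply, Fintype.sum_prod_type, snocMatrix₃, consMatrix, triangleMatrix, hs]

variable [Fintype V]

/-- The equal-range test in `U` is redundant, as a nonzero weight forces it. -/
theorem U_val (j : ℕ) :
    (W.U S j).1 = localMatrix (Path.base₂ (k := j)) Path.word₂ W.weightMatrix := by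
  ext μ ν
  exact ite_and_zero_of_imp fun h => (W.exists_of_weight_ne_zero h).2.2.2

theorem isSelfAdjoint_U (j : ℕ) : IsSelfAdjoint (W.U S j) := by
  apply Subtype.ext
  change star (W.U S j).1 = (W.U S j).1
  rw [U_val]
  ext μ ν
  rw [Matrix.star_apply]
  by_cases h : μ.base₂ = ν.base₂
  · rw [localMatrix_apply_of_eq h, localMatrix_apply_of_eq h.symm]
    exact W.conj_weight _ _ _ _
  · rw [localMatrix_apply_of_ne h, localMatrix_apply_of_ne (Ne.symm h), star_zero]

theorem U_sq (hφ : ∀ v, 0 < φ v) (j : ℕ) : W.U S j ^ 2 = qNumber q 2 • W.U S j := by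
  apply Subtype.ext
  change (W.U S j).1 ^ 2 = qNumber q 2 • (W.U S j).1
  rw [U_val, sq, localMatrix_mul Path.ext₂ W.weightMatrix_range, ← localMatrix_smul]
  refine localMatrix_congr fun μ ν _ => ?_
  rw [Matrix.mul_apply, Fintype.sum_prod_type]
  exact W.sum_weight_mul_weight hφ _ _ _ _

theorem incMatrix_U_val (j : ℕ) : G.incMatrix S (W.U S j).1 =
    localMatrix (Path.base₃ (k := j)) Path.word₃ (snocMatrix₂ W.weightMatrix) := by
  rw [U_val, incMatrix_localMatrix₂]

theorem U_succ_val (j : ℕ) : (W.U S (j + 1)).1 =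
    localMatrix (Path.base₃ (k := j)) Path.word₃ (consMatrix W.weightMatrix) := by
  rw [U_val, localMatrix_consMatrix₂]

/-- `U₁ U₂ U₁ - U₁` is the operator given by the triangles. -/
theorem left_sub_eq (hφ : ∀ v, 0 < φ v) (j : ℕ) :
    G.incMatrix S (W.U S j).1 * ((W.U S (j + 1)).1 * G.incMatrix S (W.U S j).1)
        - G.incMatrix S (W.U S j).1
      = localMatrix (Path.base₃ (k := j)) Path.word₃ W.triangleMatrix := by
  -- Right-nested products keep a single weight matrix as the left factor, the one whose
  -- realisability is checked.
  rw [incMatrix_U_val, U_succ_val, localMatrix_mul Path.ext₃ W.consMatrix₂_range,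
    localMatrix_mul Path.ext₃ W.snocMatrix₂_range, ← localMatrix_sub]
  refine localMatrix_congr fun μ ν h => ?_
  have hs := Path.s_word₃_eq h
  have hb : G.r μ.word₃.2.1 = G.s μ.word₃.2.2 := μ.s_last_init.symm
  have hb' : G.r ν.word₃.2.1 = G.s ν.word₃.2.2 := ν.s_last_init.symm
  generalize μ.word₃ = p at *
  generalize ν.word₃ = p' at *
  obtain ⟨a, b, c⟩ := p
  obtain ⟨a', b', c'⟩ := p'
  rw [Matrix.sub_apply, snocMatrix₂_mul_consMatrix_mul_snocMatrix₂_apply,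
    W.sum_weight_left hφ hb hb' hs, triangleMatrix, Matrix.of_apply, if_pos hs]
  exact add_sub_cancel_left _ _

theorem right_sub_eq (hφ : ∀ v, 0 < φ v) (j : ℕ) :
    (W.U S (j + 1)).1 * (G.incMatrix S (W.U S j).1 * (W.U S (j + 1)).1) - (W.U S (j + 1)).1
      = localMatrix (Path.base₃ (k := j)) Path.word₃ W.triangleMatrix := by
  rw [incMatrix_U_val, U_succ_val, localMatrix_mul Path.ext₃ W.snocMatrix₂_range,
    localMatrix_mul Path.ext₃ W.consMatrix₂_range, ← localMatrix_sub]
  refine localMatrix_congr fun μ ν h => ?_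
  have hs := Path.s_word₃_eq h
  have hb : G.r μ.word₃.1 = G.s μ.word₃.2.1 := μ.init.s_last_init.symm
  have hb' : G.r ν.word₃.1 = G.s ν.word₃.2.1 := ν.init.s_last_init.symm
  generalize μ.word₃ = p at *
  generalize ν.word₃ = p' at *
  obtain ⟨a, b, c⟩ := p
  obtain ⟨a', b', c'⟩ := p'
  rw [Matrix.sub_apply, consMatrix_mul_snocMatrix₂_mul_consMatrix_apply,
    W.sum_weight_right hφ hb hb' hs, triangleMatrix, Matrix.of_apply, if_pos hs]
  exact add_sub_cancel_left _ _

/-- `U₃ Q M = [2] U₁ M`, where `Q` and `M` are the operators given by the triangles on the first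
and on the last three edges of a path. -/
theorem mul_triangle_mul_triangle (hφ : ∀ v, 0 < φ v) (j : ℕ) :
    localMatrix (Path.base₄ (G := G) (S := S) (k := j)) Path.word₄
        (consMatrix (consMatrix W.weightMatrix)) *
      (localMatrix Path.base₄ Path.word₄ (snocMatrix₃ W.triangleMatrix) *
        localMatrix Path.base₄ Path.word₄ (consMatrix W.triangleMatrix))
      = qNumber q 2 • (localMatrix Path.base₄ Path.word₄
          (snocMatrix₃ (snocMatrix₂ W.weightMatrix)) *
        localMatrix Path.base₄ Path.word₄ (consMatrix W.triangleMatrix)) := by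
  classical
  rw [localMatrix_mul Path.ext₄ W.triangleMatrix_snoc_range,
    localMatrix_mul Path.ext₄ W.consMatrix_cons_range,
    localMatrix_mul Path.ext₄ W.snocMatrix₂_snoc_range, ← localMatrix_smul]
  refine localMatrix_congr fun μ ν h => ?_
  have hs : G.s μ.word₄.1 = G.s ν.word₄.1 :=
    (μ.init.init.init.s_last.trans (congrArg Path.range h)).trans ν.init.init.init.s_last.symm
  have ha : G.r μ.word₄.2.1 = G.s μ.word₄.2.2.1 := μ.init.s_last_init.symm
  have ha' : G.r ν.word₄.1 = G.s ν.word₄.2.1 := ν.init.init.s_last_init.symm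
  generalize μ.word₄ = p at *
  generalize ν.word₄ = p' at *
  obtain ⟨e, a, b, c⟩ := p
  obtain ⟨e', a', b', c'⟩ := p'
  dsimp only at hs ha ha'
  have h1 : ∀ x, (W.weight e' x e a *
      if G.s x = G.s a' then W.triangleWeight x b c a' b' c' else 0)
        = W.weight e' x e a * W.triangleWeight x b c a' b' c' := by
    intro x
    by_cases h0 : W.weight e' x e a = 0
    · simp [h0]
    · rw [if_pos ((W.exists_of_weight_ne_zero h0).2.1.symm.trans ha')]
  have h2 : (snocMatrix₃ (snocMatrix₂ W.weightMatrix) * consMatrix W.triangleMatrix :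
      Matrix (E × E × E × E) (E × E × E × E) ℂ) (e, a, b, c) (e', a', b', c')
      = ∑ x, W.weight e' x e a * W.triangleWeight x b c a' b' c' := by
    simp only [← h1]
    simp [Matrix.mul_apply, Fintype.sum_prod_type, snocMatrix₃, snocMatrix₂, consMatrix,
      triangleMatrix, weightMatrix]
  rw [Matrix.smul_apply, h2, ← W.sum_weight_mul_W hs ha]
  simp only [Matrix.mul_apply (M := consMatrix _), Fintype.sum_prod_type,
    W.snocMatrix₃_mul_consMatrix_triangleMatrix_apply hφ ha']
  simp only [consMatrix, weightMatrix, Matrix.of_apply, ite_mul, zero_mul,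
    Finset.sum_ite_irrel, Finset.sum_const_zero, Finset.sum_ite_eq, Finset.mem_univ, if_true]
  simp only [hs, mul_ite, mul_zero, if_true, Finset.sum_ite_eq', Finset.mem_univ, smul_eq_mul,
    Finset.mul_sum]
  exact Finset.sum_congr rfl fun x _ => by ring

end CellSystem

/-! ### Functoriality of the inclusions between the path algebras. -/

section Embedding

variable [Fintype V] [Fintype E]

theorem pathEmb_self (k : ℕ) (x : G.pathAlg S k) : G.pathEmb S le_rfl x = x := by
  simp [pathEmb, Nat.leRec_self]

theorem pathEmb_succ_apply {k m : ℕ} (h : k ≤ m) (x : G.pathAlg S k) :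
    G.pathEmb S (Nat.le_succ_of_le h) x = G.pathInc S m (G.pathEmb S h x) := by
  simp [pathEmb, Nat.leRec_succ _ _ h]

theorem pathEmb_trans {k l m : ℕ} (h : k ≤ l) (h' : l ≤ m) (x : G.pathAlg S k) :
    G.pathEmb S (h.trans h') x = G.pathEmb S h' (G.pathEmb S h x) := by
  induction m, h' using Nat.le_induction with
  | base => rw [pathEmb_self]
  | succ m hm ih =>
    rw [pathEmb_succ_apply (h.trans hm), pathEmb_succ_apply hm, ih]

theorem pathEmb_succ (k : ℕ) (x : G.pathAlg S k) :
    G.pathEmb S (Nat.le_succ k) x = G.pathInc S k x := by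
  rw [pathEmb_succ_apply le_rfl, pathEmb_self]

end Embedding

/-! ### The relations inside the path algebras. -/

namespace CellSystem

variable [Fintype V] [Fintype E] {q : ℂ} {φ : V → ℝ} (W : G.CellSystem q φ)

theorem pathInc_pathInc_commute (j : ℕ) (x : G.pathAlg S j) :
    Commute (G.pathInc S (j + 1) (G.pathInc S j x)) (W.U S j) := by
  apply Subtype.ext
  change G.incMatrix S (G.incMatrix S x.1) * (W.U S j).1
    = (W.U S j).1 * G.incMatrix S (G.incMatrix S x.1)
  classical
  have hx : ∀ μ ν : G.Path S (j + 2), G.incMatrix S (G.incMatrix S x.1) μ ν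
      = if μ.word₂ = ν.word₂ then x.1 μ.base₂ ν.base₂ else 0 := by
    intro μ ν
    change (if μ.last = ν.last then if μ.init.last = ν.init.last then
      x.1 μ.base₂ ν.base₂ else 0 else 0) = _
    by_cases h1 : μ.last = ν.last <;> by_cases h2 : μ.init.last = ν.init.last <;>
      simp [Path.word₂, h1, h2]
  rw [U_val]
  ext μ ν
  rw [Matrix.mul_apply, Matrix.mul_apply]
  have hl : ∀ κ, G.incMatrix S (G.incMatrix S x.1) μ κ *
      localMatrix (Path.base₂ (k := j)) Path.word₂ W.weightMatrix κ ν =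
      if κ.base₂ = ν.base₂ ∧ κ.word₂ = μ.word₂ then
        x.1 μ.base₂ ν.base₂ * W.weightMatrix μ.word₂ ν.word₂ else 0 := by
    intro κ
    rw [hx]
    by_cases h1 : κ.base₂ = ν.base₂
    · rw [localMatrix_apply_of_eq h1]
      by_cases h2 : κ.word₂ = μ.word₂
      · simp [h1, h2]
      · simp [h2, Ne.symm h2]
    · rw [localMatrix_apply_of_ne h1]; simp [h1]
  have hr : ∀ κ, localMatrix (Path.base₂ (k := j)) Path.word₂ W.weightMatrix μ κ *
      G.incMatrix S (G.incMatrix S x.1) κ ν =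
      if κ.base₂ = μ.base₂ ∧ κ.word₂ = ν.word₂ then
        x.1 μ.base₂ ν.base₂ * W.weightMatrix μ.word₂ ν.word₂ else 0 := by
    intro κ
    rw [hx]
    by_cases h1 : μ.base₂ = κ.base₂
    · rw [localMatrix_apply_of_eq h1]
      by_cases h2 : κ.word₂ = ν.word₂
      · simp [h1, h2, mul_comm]
      · simp [h2]
    · rw [localMatrix_apply_of_ne h1]; simp [Ne.symm h1]
  simp only [hl, hr]
  by_cases h0 : x.1 μ.base₂ ν.base₂ = 0
  · simp [h0]
  -- A nonzero entry of `x` makes the two bases end at the same vertex, so their two-edge tails can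
  -- be exchanged; each product then has exactly one surviving intermediate path.
  have hrange : μ.base₂.range = ν.base₂.range := by
    by_contra hc
    exact h0 (x.2 _ _ hc)
  obtain ⟨κ, h1, h2⟩ := Path.exists₂ ν.base₂ μ.word₂
    (μ.init.s_last.trans hrange) μ.s_last_init.symm
  obtain ⟨κ', h1', h2'⟩ := Path.exists₂ μ.base₂ ν.word₂
    (ν.init.s_last.trans hrange.symm) ν.s_last_init.symm
  have e1 : ∀ τ : G.Path S (j + 2), (τ.base₂ = ν.base₂ ∧ τ.word₂ = μ.word₂) ↔ τ = κ :=
    fun τ => ⟨fun h => Path.ext₂ _ _ (h.1.trans h1.symm) (h.2.trans h2.symm),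
      fun h => h ▸ ⟨h1, h2⟩⟩
  have e2 : ∀ τ : G.Path S (j + 2), (τ.base₂ = μ.base₂ ∧ τ.word₂ = ν.word₂) ↔ τ = κ' :=
    fun τ => ⟨fun h => Path.ext₂ _ _ (h.1.trans h1'.symm) (h.2.trans h2'.symm),
      fun h => h ▸ ⟨h1', h2'⟩⟩
  simp [e1, e2]

theorem pathEmb_commute {k j : ℕ} (h : k ≤ j) (x : G.pathAlg S k) :
    Commute (G.pathEmb S (h.trans (Nat.le_add_right j 2)) x) (W.U S j) := by
  rw [pathEmb_succ_apply (h.trans (Nat.le_succ j)), pathEmb_succ_apply h]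
  exact W.pathInc_pathInc_commute j _

theorem pathInc_U_mul_U_mul_pathInc_U_sub (hφ : ∀ v, 0 < φ v) (j : ℕ) :
    G.pathInc S (j + 2) (W.U S j) * W.U S (j + 1) * G.pathInc S (j + 2) (W.U S j)
        - G.pathInc S (j + 2) (W.U S j)
      = W.U S (j + 1) * G.pathInc S (j + 2) (W.U S j) * W.U S (j + 1) - W.U S (j + 1) := by
  apply Subtype.ext
  rw [mul_assoc, mul_assoc]
  exact (W.left_sub_eq hφ j).trans (W.right_sub_eq hφ j).symm

theorem U_eq_zero_of_qNumber_eq_zero (hq : qNumber q 2 = 0) (j : ℕ) : W.U S j = 0 := by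
  have hW : ∀ a b c, W.W a b c = 0 := by
    intro a b c
    have h := W.typeI_same a
    -- Type I now says that a sum of squared moduli is zero.
    simp only [hq, zero_mul, Complex.mul_conj, ← Complex.ofReal_sum, Complex.ofReal_eq_zero] at h
    rw [Finset.sum_eq_zero_iff_of_nonneg
      fun _ _ => Finset.sum_nonneg fun _ _ => Complex.normSq_nonneg _] at h
    have h' := h b (Finset.mem_univ b)
    rw [Finset.sum_eq_zero_iff_of_nonneg fun _ _ => Complex.normSq_nonneg _] at h'
    exact Complex.normSq_eq_zero.1 (h' c (Finset.mem_univ c))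
  apply Subtype.ext
  ext μ ν
  simp [U, weight, hW]

theorem mul_commutator_mul_commutator (hφ : ∀ v, 0 < φ v) (j : ℕ)
    {U₁ U₂ U₃ : G.pathAlg S (j + 4)}
    (h₁ : U₁ = G.pathInc S (j + 3) (G.pathInc S (j + 2) (W.U S j)))
    (h₂ : U₂ = G.pathInc S (j + 3) (W.U S (j + 1))) (h₃ : U₃ = W.U S (j + 2)) :
    U₃ * ((U₁ * U₂ * U₁ - U₁) * (U₂ * U₃ * U₂ - U₂))
      = qNumber q 2 • (U₁ * (U₂ * U₃ * U₂ - U₂)) := by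
  have hQ : (U₁ * U₂ * U₁ - U₁).1
      = localMatrix (Path.base₄ (k := j)) Path.word₄ (snocMatrix₃ W.triangleMatrix) := by
    rw [h₁, h₂, ← map_mul, ← map_mul, ← map_sub, mul_assoc, ← incMatrix_localMatrix₃,
      ← W.left_sub_eq hφ j]
    rfl
  have hM : (U₂ * U₃ * U₂ - U₂).1
      = localMatrix (Path.base₄ (k := j)) Path.word₄ (consMatrix W.triangleMatrix) := by
    rw [← localMatrix_consMatrix₃, ← W.left_sub_eq hφ (j + 1), h₂, h₃, mul_assoc]
    rfl
  have hU₁ : U₁.1 = localMatrix (Path.base₄ (k := j)) Path.word₄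
      (snocMatrix₃ (snocMatrix₂ W.weightMatrix)) := by
    rw [← incMatrix_localMatrix₃, ← incMatrix_U_val, h₁]
    rfl
  have hU₃ : U₃.1 = localMatrix (Path.base₄ (k := j)) Path.word₄
      (consMatrix (consMatrix W.weightMatrix)) := by
    rw [← localMatrix_consMatrix₃, ← U_succ_val, h₃]
  apply Subtype.ext
  change U₃.1 * ((U₁ * U₂ * U₁ - U₁).1 * (U₂ * U₃ * U₂ - U₂).1)
    = qNumber q 2 • (U₁.1 * (U₂ * U₃ * U₂ - U₂).1)
  rw [hQ, hM, hU₁, hU₃]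
  exact W.mul_triangle_mul_triangle hφ j

end CellSystem
end EdgeGraph

/-- Purely algebraic: `M = U₂U₃U₂ - U₂` is scaled by `δ` under `U₂` and, through H3, under `U₃`.
Writing `δM` as `U₂M` brings `U₂U₁U₂` into `U₃U₂U₁M`, where the remaining hypothesis applies. -/
theorem antisymmetrizer_eq_zero {A : Type*} [Ring A] [Algebra ℂ A] {δ : ℂ} (hδ : δ ≠ 0)
    {U₁ U₂ U₃ : A} (h₂ : U₂ ^ 2 = δ • U₂) (h₃ : U₃ ^ 2 = δ • U₃)
    (h₁₂ : U₁ * U₂ * U₁ - U₁ = U₂ * U₁ * U₂ - U₂) (h₂₃ : U₂ * U₃ * U₂ - U₂ = U₃ * U₂ * U₃ - U₃)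
    (h : U₃ * ((U₁ * U₂ * U₁ - U₁) * (U₂ * U₃ * U₂ - U₂))
      = δ • (U₁ * (U₂ * U₃ * U₂ - U₂))) :
    (U₁ - U₃ * U₂ * U₁ + U₂) * (U₂ * U₃ * U₂ - U₂) = 0 := by
  have e₂ : U₂ * (U₂ * U₃ * U₂ - U₂) = δ • (U₂ * U₃ * U₂ - U₂) := by
    rw [mul_sub, ← mul_assoc, ← mul_assoc, ← sq, h₂, smul_mul_assoc, smul_mul_assoc, smul_sub]
  have e₃ : U₃ * (U₂ * U₃ * U₂ - U₂) = δ • (U₂ * U₃ * U₂ - U₂) := by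
    rw [h₂₃, mul_sub, ← mul_assoc, ← mul_assoc, ← sq, h₃, smul_mul_assoc, smul_mul_assoc, smul_sub]
  generalize U₂ * U₃ * U₂ - U₂ = M at *
  have key : δ • (U₃ * U₂ * U₁ * M) = δ • (δ • M + U₁ * M) := by
    calc δ • (U₃ * U₂ * U₁ * M) = U₃ * U₂ * U₁ * (U₂ * M) := by rw [e₂, mul_smul_comm]
      _ = U₃ * ((U₂ * U₁ * U₂ - U₂) * M) + U₃ * (U₂ * M) := by noncomm_ring
      _ = δ • (δ • M + U₁ * M) := by
        rw [← h₁₂, h, e₂, mul_smul_comm, e₃, smul_add, add_comm]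
  have key' := smul_right_injective A hδ key
  rw [add_mul, sub_mul, key', e₂]
  abel

/-- The operators `U_1, …, U_N`, regarded as elements of `M_{N+1}`, satisfy the
`SU(3)`-Temperley-Lieb relations with parameter `[2]_q`, for every `N`. -/
theorem mainTheorem5 {V E : Type u} [Fintype V] [Fintype E] (G : EdgeGraph V E) (S : Set V)
    (q : ℂ) (hq0 : q ≠ 0) (hq1 : q ^ 2 ≠ 1) (φ : V → ℝ)
    (hφ : G.IsPerronFrobenius φ (qNumber q 3)) (W : G.CellSystem q φ) (N : ℕ) :
    IsSU3TemperleyLieb (A := G.pathAlg S (N + 1)) (qNumber q 2)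
      (fun i : Fin N => G.pathEmb S (Nat.succ_le_succ i.isLt) (W.U S i)) := by
  have hpos := hφ.1
  refine ⟨fun i => ?_, fun i => ?_, fun i j hij => ?_, fun i j hj => ?_, fun i j k hj hk => ?_⟩
  · exact (W.isSelfAdjoint_U i).map _
  · rw [← map_pow, W.U_sq hpos, map_smul]
  · have key : ∀ i j : Fin N, (i : ℕ) + 2 ≤ j →
        Commute (G.pathEmb S (Nat.succ_le_succ i.isLt) (W.U S i))
          (G.pathEmb S (Nat.succ_le_succ j.isLt) (W.U S j)) := by
      intro i j h
      -- `W.U S i` lies in `M_{i+2}` with `i + 2 ≤ j`, so it commutes with `W.U S j` already in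
      -- `M_{j+2}`.
      rw [EdgeGraph.pathEmb_trans (h.trans (Nat.le_add_right (j : ℕ) 2))
        (Nat.succ_le_succ j.isLt)]
      exact (W.pathEmb_commute h _).map _
    rcases le_total (i : ℕ) j with h | h
    · exact key i j (by rw [abs_sub_comm, lt_abs] at hij; omega)
    · exact (key j i (by rw [lt_abs] at hij; omega)).symm
  · obtain ⟨i, hi⟩ := i
    obtain ⟨j, hj'⟩ := j
    obtain rfl : j = i + 1 := hj
    dsimp only
    rw [EdgeGraph.pathEmb_trans (Nat.le_succ (i + 2)) (Nat.succ_le_succ hj'),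
      EdgeGraph.pathEmb_succ]
    have h := congrArg (G.pathEmb S (Nat.succ_le_succ hj'))
      (W.pathInc_U_mul_U_mul_pathInc_U_sub hpos i)
    simpa only [map_sub, map_mul] using h
  · obtain ⟨i, hi⟩ := i
    obtain ⟨j, hj'⟩ := j
    obtain ⟨k, hk'⟩ := k
    obtain rfl : j = i + 1 := hj
    obtain rfl : k = i + 2 := hk
    dsimp only
    rw [EdgeGraph.pathEmb_trans (Nat.le_succ (i + 3)) (Nat.succ_le_succ hk') (W.U S (i + 1)),
      EdgeGraph.pathEmb_trans (Nat.le_succ_of_le (Nat.le_succ (i + 2))) (Nat.succ_le_succ hk')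
        (W.U S i),
      EdgeGraph.pathEmb_succ, EdgeGraph.pathEmb_succ_apply (Nat.le_succ (i + 2)),
      EdgeGraph.pathEmb_succ]
    -- Cancelling `[2]` needs it nonzero, and `q² = -1` is allowed; in that case all the operators
    -- are zero.
    by_cases hq : qNumber q 2 = 0
    · simp only [W.U_eq_zero_of_qNumber_eq_zero hq, map_zero, mul_zero, sub_zero]
    have h₁₂ := congrArg (G.pathInc S (i + 3)) (W.pathInc_U_mul_U_mul_pathInc_U_sub hpos i)
    simp only [map_sub, map_mul] at h₁₂
    have h₂ := congrArg (G.pathInc S (i + 3)) (W.U_sq hpos (i + 1))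
    rw [map_pow, map_smul] at h₂
    have h := antisymmetrizer_eq_zero hq h₂ (W.U_sq hpos (i + 2)) h₁₂
      (W.pathInc_U_mul_U_mul_pathInc_U_sub hpos (i + 1))
      (W.mul_commutator_mul_commutator hpos i rfl rfl rfl)
    have h' := congrArg (G.pathEmb S (Nat.succ_le_succ hk')) h
    simpa only [map_sub, map_mul, map_add, map_zero] using h'
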